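/- Let $\mathcal X$ be a compact subset of $\mathbb R^d$, let $\mathcal M$ be the set of all probability measures on the Borel subsets of $\mathcal X$, and let $k\in\{1,\dots,d\}$. For $\mu\in\mathcal M$ let $E_\mu$ be the mean and $V_\mu$ the covariance matrix of $\mu$, and let $$\psi_k(\mu)=\int\cdots\int \mathcal V_k^2(x_1,\dots,x_{k+1})\,\mu(dx_1)\cdots\mu(dx_{k+1}),$$ where $\mathcal V_k(x_1,\dots,x_{k+1})$ is the $k$-dimensional volume of the simplex with vertices $x_1,\dots,x_{k+1}$, that is, $\frac1{k!}$ times the square root of the Gram determinant of $x_2-x_1,\dots,x_{k+1}-x_1$. For a $d\times d$ matrix $V$ let $\Psi_k(V)=\frac{k+1}{k!}\,\mathcal E_k(V)$, where $\mathcal E_k(V)$ is the elementary symmetric function of degree $k$ of the $d$ eigenvalues of $V$ (that is, $(-1)^k$ times the coefficient of $t^{d-k}$ in $\det(tI-V)$), and let $\nabla\Psi_k[V]$ be its gradient at $V$, the matrix of the partial derivatives of $\Psi_k$ with respect to the entries of $V$. Let $\mu_k^*\in\mathcal M$ be such that $\psi_k(\mu_k^*)>0$. Then $\mu_k^*$ maximises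 $\psi_k$ over $\mathcal M$ if and only if $$\max_{x\in\mathcal X}\,(x-E_{\mu_k^*})^T\,\frac{\nabla\Psi_k[V_{\mu_k^*}]}{\Psi_k(V_{\mu_k^*})}\,(x-E_{\mu_k^*})\le k.$$ Moreover, if $\mu_k^*$ maximises $\psi_k$ over $\mathcal M$, then $$(x-E_{\mu_k^*})^T\,\frac{\nabla\Psi_k[V_{\mu_k^*}]}{\Psi_k(V_{\mu_k^*})}\,(x-E_{\mu_k^*})=k$$ for all $x$ in the support of $\mu_k^*$. -/

import Mathlib

open scoped Matrix

noncomputable section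

namespace MaxDiversity

/-- `ℝ^d` with its Euclidean norm and inner product. -/
abbrev E (d : ℕ) : Type := EuclideanSpace ℝ (Fin d)

/-- The probability measures on the Borel subsets of `X`, seen as the Borel probability measures
on `ℝ^d` that give no mass to the complement of `X`. -/
def probMeasures {d : ℕ} (X : Set (E d)) : Set (MeasureTheory.Measure (E d)) :=
  {μ | MeasureTheory.IsProbabilityMeasure μ ∧ μ Xᶜ = 0}

/-- The `k`-dimensional volume of the simplex with vertices `x 0, …, x k` in `ℝ^d`:
`1 / k!` times the `k`-dimensional volume of the parallelotope spanned by the edge vectors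
`x 1 - x 0, …, x k - x 0`, i.e. the square root of their Gram determinant. -/
def simplexVolume {d k : ℕ} (x : Fin (k + 1) → E d) : ℝ :=
  Real.sqrt (Matrix.gram ℝ (fun i : Fin k => x i.succ - x 0)).det / (k.factorial : ℝ)

/-- The mean squared volume of the `k`-simplex whose `k + 1` vertices are drawn independently
from `μ`. -/
def psi {d : ℕ} (k : ℕ) (μ : MeasureTheory.Measure (E d)) : ℝ :=
  ∫ x : Fin (k + 1) → E d, simplexVolume x ^ 2 ∂(MeasureTheory.Measure.pi fun _ => μ)

/-- The mean of `μ`. -/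
def mean {d : ℕ} (μ : MeasureTheory.Measure (E d)) : E d := ∫ x, x ∂μ

/-- The covariance matrix of `μ`. -/
def covMatrix {d : ℕ} (μ : MeasureTheory.Measure (E d)) : Matrix (Fin d) (Fin d) ℝ :=
  Matrix.of fun i j => ProbabilityTheory.covariance (fun x : E d => x i) (fun x : E d => x j) μ

/-- The elementary symmetric function of degree `k ≤ d` of the eigenvalues of a `d × d` matrix,
given by the coefficient of degree `d - k` of the characteristic polynomial `det (t I - V)`. -/
def elemSym {d : ℕ} (k : ℕ) (V : Matrix (Fin d) (Fin d) ℝ) : ℝ :=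
  (-1) ^ k * V.charpoly.coeff (d - k)

/-- For a symmetric matrix `elemSym` is the elementary symmetric function of the eigenvalues. -/
theorem elemSym_eq_esymm {d k : ℕ} (hk : k ≤ d) {V : Matrix (Fin d) (Fin d) ℝ}
    (hV : V.IsHermitian) :
    elemSym k V = ∑ s ∈ Finset.powersetCard k Finset.univ, ∏ i ∈ s, hV.eigenvalues i := by
  have h := Multiset.prod_X_sub_C_coeff (Finset.univ.val.map hV.eigenvalues) (k := d - k) (by simp)
  rw [Multiset.map_map] at h
  have h2 : V.charpoly = (Multiset.map ((fun t => Polynomial.X - Polynomial.C t) ∘ hV.eigenvalues)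
      Finset.univ.val).prod := by
    rw [hV.charpoly_eq]; rfl
  have h3 : d - (d - k) = k := by omega
  rw [elemSym, h2, h, Finset.esymm_map_val]
  simp only [Multiset.card_map, Finset.card_val, Finset.card_univ, Fintype.card_fin, h3]
  rw [← mul_assoc, ← pow_add, Even.neg_one_pow ⟨k, rfl⟩, one_mul]

/-- `Ψ_k(V) = (k + 1) / k! * 𝓔_k(V)`. -/
def Psi {d : ℕ} (k : ℕ) (V : Matrix (Fin d) (Fin d) ℝ) : ℝ :=
  ((k : ℝ) + 1) / (k.factorial : ℝ) * elemSym k V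

/-- The gradient of `Ψ_k` at `V`: the matrix of the partial derivatives of `Ψ_k` with respect to
the entries of the matrix. (`Ψ_k` is a polynomial in these entries.) -/
def gradPsi {d : ℕ} (k : ℕ) (V : Matrix (Fin d) (Fin d) ℝ) : Matrix (Fin d) (Fin d) ℝ :=
  Matrix.of fun i j => deriv (fun t : ℝ => Psi k (V + t • Matrix.single i j (1 : ℝ))) 0

/-- `(x - E_μ)ᵀ (∇Ψ_k[V_μ] / Ψ_k(V_μ)) (x - E_μ)`. -/
def sensitivity {d : ℕ} (k : ℕ) (μ : MeasureTheory.Measure (E d)) (x : E d) : ℝ :=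
  (x - mean μ).ofLp ⬝ᵥ
    (((Psi k (covMatrix μ))⁻¹ • gradPsi k (covMatrix μ)) *ᵥ (x - mean μ).ofLp)

end MaxDiversity

end

open Polynomial MaxDiversity MeasureTheory

/-! Two facts carry the proof. (1) `psi_eq_Psi`: the criterion depends on the measure only through
its covariance matrix. The Gram determinant is a sum of squared `k × k` determinants, and Andréief's
identity integrates each of them to `(k+1)!` times a principal minor of the covariance. (2)
`Psi_le_mul_exp`: a first-order bound expressing the log-concavity of `Psi k`. For `V` positive
semidefinite with `elemSym k V > 0` and `W` positive definite, the polynomial `elemSym k (V + t W)`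
has only real negative roots, so it equals `elemSym k V * ∏ (1 + a t)` with `k` numbers `a > 0`.
Then `elemSym k W = elemSym k V * ∏ a`, the derivative at `0` is `elemSym k V * ∑ a`, and `a ≤ exp
(a - 1)` compares the two.

Sufficiency: the sensitivity integrated against a competitor `ν` pairs the gradient with `V_ν` plus
a rank-one term, and (2) applies. Necessity: the criterion cannot increase when `μ` is mixed with a
point mass. Equality on the support: by Euler's identity the sensitivity has `μ`-average exactly
`k`. -/

/-! ### Elementary symmetric functions and matrix pencils -/

/-- The sum of the principal minors of order `k` of `V + X W`, as a polynomial in `X`. -/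
noncomputable def minorPencil {d : ℕ} (k : ℕ) (V W : Matrix (Fin d) (Fin d) ℝ) : ℝ[X] :=
  ∑ s ∈ Finset.univ.powersetCard k,
    ((X : ℝ[X]) • (W.submatrix (Subtype.val : s → Fin d) Subtype.val).map C +
      (V.submatrix (Subtype.val : s → Fin d) Subtype.val).map C).det

theorem elemSym_eq_sum_minors {d k : ℕ} (hk : k ≤ d) (V : Matrix (Fin d) (Fin d) ℝ) :
    elemSym k V = ∑ s ∈ Finset.univ.powersetCard k,
      (V.submatrix (Subtype.val : s → Fin d) Subtype.val).det := by
  have h := Matrix.charpoly_coeff_eq_sum_minors V k (by simpa using hk)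
  rw [Fintype.card_fin] at h
  rw [elemSym, h, ← mul_assoc, ← pow_add, Even.neg_one_pow ⟨k, rfl⟩, one_mul]

/-- A general target ring lets the same real polynomial be evaluated at complex `z`, where its roots
are located. -/
theorem eval₂_minorPencil {d k : ℕ} (hk : k ≤ d) {R : Type*} [CommRing R] (φ : ℝ →+* R)
    (V W : Matrix (Fin d) (Fin d) ℝ) (z : R) :
    (minorPencil k V W).eval₂ φ z =
      (-1) ^ k * (V.map φ + z • W.map φ).charpoly.coeff (d - k) := by
  have h := Matrix.charpoly_coeff_eq_sum_minors (V.map φ + z • W.map φ) k (by simpa using hk)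
  rw [Fintype.card_fin] at h
  rw [h, ← mul_assoc, ← pow_add, Even.neg_one_pow ⟨k, rfl⟩, one_mul, minorPencil,
    eval₂_finsetSum]
  refine Finset.sum_congr rfl fun s _ => ?_
  rw [← coe_eval₂RingHom, RingHom.map_det]
  congr 1
  ext i j
  simp [add_comm (φ _), mul_comm z]

theorem eval_minorPencil {d k : ℕ} (hk : k ≤ d) (V W : Matrix (Fin d) (Fin d) ℝ) (t : ℝ) :
    (minorPencil k V W).eval t = elemSym k (V + t • W) := by
  have h := eval₂_minorPencil hk (RingHom.id ℝ) V W t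
  simpa [elemSym, eval₂_id] using h

theorem natDegree_minorPencil_le {d k : ℕ} (V W : Matrix (Fin d) (Fin d) ℝ) :
    (minorPencil k V W).natDegree ≤ k := by
  refine natDegree_sum_le_of_forall_le _ _ fun s hs => ?_
  refine (natDegree_det_X_add_C_le _ _).trans ?_
  simp [(Finset.mem_powersetCard.1 hs).2]

theorem coeff_minorPencil {d k : ℕ} (hk : k ≤ d) (V W : Matrix (Fin d) (Fin d) ℝ) :
    (minorPencil k V W).coeff k = elemSym k W := by
  rw [minorPencil, finsetSum_coeff, elemSym_eq_sum_minors hk]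
  refine Finset.sum_congr rfl fun s hs => ?_
  have h := coeff_det_X_add_C_card (W.submatrix (Subtype.val : s → Fin d) Subtype.val)
    (V.submatrix (Subtype.val : s → Fin d) Subtype.val)
  rwa [Fintype.card_coe, (Finset.mem_powersetCard.1 hs).2] at h

theorem elemSym_smul {d k : ℕ} (hk : k ≤ d) (c : ℝ) (V : Matrix (Fin d) (Fin d) ℝ) :
    elemSym k (c • V) = c ^ k * elemSym k V := by
  rw [elemSym_eq_sum_minors hk, elemSym_eq_sum_minors hk, Finset.mul_sum]
  refine Finset.sum_congr rfl fun s hs => ?_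
  rw [Matrix.submatrix_smul, Pi.smul_apply, Pi.smul_apply, Matrix.det_smul, Fintype.card_coe, (Finset.mem_powersetCard.1 hs).2]

theorem elemSym_nonneg {d k : ℕ} (hk : k ≤ d) {V : Matrix (Fin d) (Fin d) ℝ}
    (hV : V.PosSemidef) : 0 ≤ elemSym k V := by
  rw [elemSym_eq_esymm hk hV.1]
  exact Finset.sum_nonneg fun s _ => Finset.prod_nonneg fun i _ => hV.eigenvalues_nonneg i

theorem elemSym_pos {d k : ℕ} (hk : k ≤ d) {V : Matrix (Fin d) (Fin d) ℝ}
    (hV : V.PosDef) : 0 < elemSym k V := by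
  rw [elemSym_eq_esymm hk hV.1]
  refine Finset.sum_pos (fun s _ => Finset.prod_pos fun i _ => hV.eigenvalues_pos i) ?_
  exact Finset.powersetCard_nonempty.2 (by simpa using hk)

/-! ### Real-rootedness and log-concavity -/

/-- An eigenvalue of `V + z W` has positive imaginary part if `z` has, for `V` symmetric and `W`
positive definite. -/
theorem im_pos_of_isRoot_charpoly {d : ℕ} {V W : Matrix (Fin d) (Fin d) ℝ}
    (hV : V.IsHermitian) (hW : W.PosDef) {z ξ : ℂ} (hz : 0 < z.im)
    (hξ : (V.map (algebraMap ℝ ℂ) + z • W.map (algebraMap ℝ ℂ)).charpoly.IsRoot ξ) :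
    0 < ξ.im := by
  set M := V.map (algebraMap ℝ ℂ) + z • W.map (algebraMap ℝ ℂ) with hM
  obtain ⟨v, hv0, hv⟩ : ∃ v : Fin d → ℂ, v ≠ 0 ∧ M *ᵥ v = ξ • v := by
    rw [IsRoot.def, Matrix.eval_charpoly] at hξ
    obtain ⟨v, hv0, hv⟩ := Matrix.exists_mulVec_eq_zero_iff.2 hξ
    refine ⟨v, hv0, ?_⟩
    rw [Matrix.sub_mulVec, sub_eq_zero] at hv
    rw [← hv]
    ext i
    simp [Matrix.mulVec, dotProduct, Matrix.scalar_apply, Matrix.diagonal_apply]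
  -- The Hermitian form of a real symmetric matrix is real: the cross terms between real and
  -- imaginary parts of `v` cancel.
  have hsplit : ∀ A : Matrix (Fin d) (Fin d) ℝ, A.IsHermitian →
      (star v ⬝ᵥ (A.map (algebraMap ℝ ℂ) *ᵥ v)) =
        (((fun i => (v i).re) ⬝ᵥ (A *ᵥ fun i => (v i).re)) +
          ((fun i => (v i).im) ⬝ᵥ (A *ᵥ fun i => (v i).im)) : ℝ) := by
    intro A hA
    apply Complex.ext
    · simp [dotProduct, Matrix.mulVec, Finset.mul_sum, ← Finset.sum_add_distrib]
    · simp only [dotProduct, Matrix.mulVec, Finset.mul_sum, Complex.im_sum, Complex.ofReal_im]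
      simp only [Pi.star_apply, RCLike.star_def, Matrix.map_apply, Complex.coe_algebraMap,
        Complex.mul_im, Complex.mul_re, Complex.conj_re, Complex.conj_im, Complex.ofReal_re,
        Complex.ofReal_im, zero_mul, add_zero, sub_zero]
      simp only [neg_mul, Finset.sum_add_distrib, Finset.sum_neg_distrib]
      rw [add_neg_eq_zero, Finset.sum_comm]
      refine Finset.sum_congr rfl fun i _ => Finset.sum_congr rfl fun j _ => ?_
      have := hA.apply i j
      simp only [star_trivial] at this
      rw [this]; ring
  have h1 : star v ⬝ᵥ (M *ᵥ v) = ξ * (star v ⬝ᵥ v) := by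
    rw [hv, dotProduct_smul, smul_eq_mul]
  rw [hM, Matrix.add_mulVec, Matrix.smul_mulVec, dotProduct_add, dotProduct_smul,
    hsplit V hV, hsplit W hW.1] at h1
  have h2 := hsplit 1 Matrix.isHermitian_one
  rw [Matrix.map_one _ (map_zero _) (map_one _), Matrix.one_mulVec] at h2
  rw [h2] at h1
  have h3 := congrArg Complex.im h1
  simp only [smul_eq_mul, Complex.add_im, Complex.ofReal_im, Complex.im_mul_ofReal, zero_add] at h3
  have hne : (fun i => (v i).re) ≠ 0 ∨ (fun i => (v i).im) ≠ 0 := by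
    by_contra! h
    refine hv0 (funext fun i => Complex.ext ?_ ?_)
    · exact congrFun h.1 i
    · exact congrFun h.2 i
  have hpos : ∀ A : Matrix (Fin d) (Fin d) ℝ, A.PosDef →
      0 < ((fun i => (v i).re) ⬝ᵥ (A *ᵥ fun i => (v i).re)) +
          ((fun i => (v i).im) ⬝ᵥ (A *ᵥ fun i => (v i).im)) := by
    intro A hA
    have hn := fun x : Fin d → ℝ => hA.posSemidef.dotProduct_mulVec_nonneg x
    have hp := fun (x : Fin d → ℝ) (hx : x ≠ 0) => hA.dotProduct_mulVec_pos hx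
    simp only [star_trivial] at hn hp
    rcases hne with h | h
    · exact add_pos_of_pos_of_nonneg (hp _ h) (hn _)
    · exact add_pos_of_nonneg_of_pos (hn _) (hp _ h)
  -- Imaginary parts in `v* M v = ξ v* v` leave `Im z * v* W v = Im ξ * v* v`.
  have h5 := mul_pos hz (hpos W hW)
  rw [h3] at h5
  exact pos_of_mul_pos_left h5 (hpos 1 Matrix.PosDef.one).le

/-- Gauss–Lucas, iterated; the bound on `m` keeps every derivative nonzero. -/
theorem iterate_derivative_roots_mem_convex {p : ℂ[X]} {U : Set ℂ} (hU : Convex ℝ U)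
    (h : ∀ z, p.IsRoot z → z ∈ U) (m : ℕ) (hm : m < p.natDegree) :
    ∀ z, (derivative^[m] p).IsRoot z → z ∈ U := by
  induction m with
  | zero => exact h
  | succ m ih =>
    intro z hz
    rw [Function.iterate_succ_apply'] at hz
    have hlt : m < p.natDegree := by omega
    have hdeg : (derivative^[m] p).natDegree = p.natDegree - m := by
      clear ih hz hm
      induction m with
      | zero => rfl
      | succ m ih =>
        rw [Function.iterate_succ_apply', natDegree_derivative, ih (by omega)]
        omega
    have hpos : 0 < (derivative^[m] p).degree := natDegree_pos_iff_degree_pos.1 (by omega)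
    have hne : derivative (derivative^[m] p) ≠ 0 := by
      intro h0
      have := derivative_eq_zero.1 h0
      omega
    have hmem := rootSet_derivative_subset_convexHull_rootSet hpos
      (mem_rootSet.2 ⟨hne, by simpa [IsRoot] using hz⟩)
    refine convexHull_min (fun w hw => ih hlt w ?_) hU hmem
    simpa [IsRoot] using (mem_rootSet.1 hw).2

/-- Up to a nonzero factor this coefficient is the value at `0` of the `(d - k)`-th derivative of
the characteristic polynomial. By Gauss–Lucas the roots of that derivative stay in the open upper
half-plane, which excludes `0`. -/
theorem coeff_charpoly_ne_zero {d k : ℕ} (hk : 1 ≤ k) (hkd : k ≤ d)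
    {V W : Matrix (Fin d) (Fin d) ℝ} (hV : V.IsHermitian) (hW : W.PosDef) {z : ℂ}
    (hz : 0 < z.im) :
    (V.map (algebraMap ℝ ℂ) + z • W.map (algebraMap ℝ ℂ)).charpoly.coeff (d - k) ≠ 0 := by
  intro h0
  set P := (V.map (algebraMap ℝ ℂ) + z • W.map (algebraMap ℝ ℂ)).charpoly with hP
  have hU : Convex ℝ {w : ℂ | 0 < w.im} := convex_halfSpace_im_gt 0
  have h1 := iterate_derivative_roots_mem_convex (p := P) hU
    (fun w hw => im_pos_of_isRoot_charpoly hV hW hz hw) (d - k)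
    (by rw [hP, Matrix.charpoly_natDegree_eq_dim, Fintype.card_fin]; omega) 0 (by
      rw [IsRoot.def, ← coeff_zero_eq_eval_zero, coeff_iterate_derivative, zero_add, h0,
        smul_zero])
  simp at h1

/-- No root lies in the upper half-plane, and the roots of a real polynomial are closed under
conjugation. -/
theorem im_eq_zero_of_minorPencil_root {d k : ℕ} (hk : 1 ≤ k) (hkd : k ≤ d)
    {V W : Matrix (Fin d) (Fin d) ℝ} (hV : V.IsHermitian) (hW : W.PosDef) {z : ℂ}
    (hz : ((minorPencil k V W).map (algebraMap ℝ ℂ)).IsRoot z) : z.im = 0 := by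
  have key : ∀ w : ℂ, ((minorPencil k V W).map (algebraMap ℝ ℂ)).IsRoot w → ¬ 0 < w.im := by
    intro w hw hpos
    rw [IsRoot.def, eval_map, eval₂_minorPencil hkd] at hw
    have := coeff_charpoly_ne_zero hk hkd hV hW hpos
    exact this ((mul_eq_zero.1 hw).resolve_left (pow_ne_zero _ (by simp)))
  have h1 := key z hz
  have h2 := key (starRingEnd ℂ z) (by
    rw [IsRoot.def, eval_map_algebraMap] at hz ⊢
    rw [aeval_conj, hz, map_zero])
  rw [Complex.conj_im] at h2
  linarith

/-- Along a positive definite direction, `elemSym k` is a product of `k` affine functions. -/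
theorem exists_elemSym_factorization {d k : ℕ} (hk : 1 ≤ k) (hkd : k ≤ d)
    {V W : Matrix (Fin d) (Fin d) ℝ} (hV : V.PosSemidef) (hW : W.PosDef)
    (hpos : 0 < elemSym k V) :
    ∃ s : Multiset ℝ, Multiset.card s = k ∧ (∀ a ∈ s, 0 < a) ∧
      elemSym k W = elemSym k V * s.prod ∧
      ∀ t : ℝ, elemSym k (V + t • W) = elemSym k V * (s.map fun a => 1 + a * t).prod := by
  set q := minorPencil k V W with hq
  have hlead : q.coeff k = elemSym k W := coeff_minorPencil hkd V W
  have hWpos := elemSym_pos hkd hW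
  have hdeg : q.natDegree = k :=
    le_antisymm (natDegree_minorPencil_le V W) (le_natDegree_of_ne_zero (by rw [hlead]; exact hWpos.ne'))
  have hsplit : q.Splits := by
    have h1 : (q.map (algebraMap ℝ ℂ)).Splits := IsAlgClosed.splits _
    refine Splits.of_splits_map_of_injective (i := algebraMap ℝ ℂ) (algebraMap ℝ ℂ).injective h1 fun z hz => ?_
    have := im_eq_zero_of_minorPencil_root hk hkd hV.1 hW (isRoot_of_mem_roots hz)
    exact ⟨z.re, Complex.ext (by simp) (by simp [this])⟩
  have hroots : ∀ a ∈ q.roots, a < 0 := by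
    intro a ha
    by_contra! h0
    have hr := isRoot_of_mem_roots ha
    rw [IsRoot.def, hq, eval_minorPencil hkd] at hr
    rcases h0.eq_or_lt with h | h
    · rw [← h] at hr; simp at hr; linarith
    · have := elemSym_pos hkd (Matrix.PosDef.posSemidef_add hV (hW.smul h))
      linarith
  have heval : ∀ t, q.eval t = elemSym k W * (q.roots.map fun a => t - a).prod := by
    intro t
    rw [hsplit.eval_eq_prod_roots, leadingCoeff, hdeg, hlead]
  have h0 : elemSym k V = elemSym k W * (q.roots.map fun a => -a).prod := by
    have := heval 0
    rw [hq, eval_minorPencil hkd] at this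
    simpa using this
  -- A root `r < 0` gives `t - r = (-r) * (1 + (-r)⁻¹ * t)`.
  refine ⟨q.roots.map fun a => (-a)⁻¹, ?_, ?_, ?_, ?_⟩
  · rw [Multiset.card_map, ← hdeg]
    exact (splits_iff_card_roots.1 hsplit)
  · intro a ha
    obtain ⟨b, hb, rfl⟩ := Multiset.mem_map.1 ha
    exact inv_pos.2 (neg_pos.2 (hroots b hb))
  · rw [h0, mul_assoc, ← Multiset.prod_map_mul, Multiset.map_congr rfl (g := fun _ => (1 : ℝ)),
      Multiset.prod_map_one, mul_one]
    intro a ha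
    have := hroots a ha
    exact mul_inv_cancel₀ (by linarith)
  · intro t
    rw [← eval_minorPencil hkd, ← hq, heval, h0, mul_assoc, Multiset.map_map, ← Multiset.prod_map_mul]
    congr 2
    refine Multiset.map_congr rfl fun a ha => ?_
    have := hroots a ha
    have hne : a ≠ 0 := this.ne
    simp only [Function.comp]
    field_simp
    ring

theorem Multiset.prod_le_exp_sum_sub_card (s : Multiset ℝ) (hs : ∀ a ∈ s, 0 ≤ a) :
    s.prod ≤ Real.exp (s.sum - Multiset.card s) := by
  induction s using Multiset.induction_on with
  | empty => simp
  | cons a s ih =>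
    have h1 := ih fun b hb => hs b (Multiset.mem_cons_of_mem hb)
    have h2 : a ≤ Real.exp (a - 1) := by linarith [Real.add_one_le_exp (a - 1)]
    rw [Multiset.prod_cons, Multiset.sum_cons, Multiset.card_cons]
    calc a * s.prod ≤ Real.exp (a - 1) * Real.exp (s.sum - Multiset.card s) := by
          gcongr
          exact Multiset.prod_nonneg fun b hb => hs b (Multiset.mem_cons_of_mem hb)
      _ = _ := by rw [← Real.exp_add]; congr 1; push_cast; ring

theorem Multiset.hasDerivAt_prod_one_add_mul (s : Multiset ℝ) :
    HasDerivAt (fun t : ℝ => (s.map fun a => 1 + a * t).prod) s.sum 0 := by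
  induction s using Multiset.induction_on with
  | empty => simpa using hasDerivAt_const (0 : ℝ) (1 : ℝ)
  | cons a s ih =>
    have h1 : HasDerivAt (fun t : ℝ => 1 + a * t) a 0 := by
      simpa using ((hasDerivAt_id (0 : ℝ)).const_mul a).const_add 1
    have h2 := h1.mul ih
    simp only [mul_zero, add_zero, Multiset.map_const', Multiset.prod_replicate, one_pow, mul_one, one_mul] at h2
    simp only [Multiset.map_cons, Multiset.prod_cons, Multiset.sum_cons]
    exact h2

/-- The first-order upper bound which expresses the concavity of `log ∘ elemSym k`. -/
theorem elemSym_le_mul_exp {d k : ℕ} (hk : 1 ≤ k) (hkd : k ≤ d)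
    {V W : Matrix (Fin d) (Fin d) ℝ} (hV : V.PosSemidef) (hW : W.PosDef)
    (hpos : 0 < elemSym k V) {c : ℝ}
    (hc : HasDerivAt (fun t : ℝ => elemSym k (V + t • W)) c 0) :
    elemSym k W ≤ elemSym k V * Real.exp (c / elemSym k V - k) := by
  obtain ⟨s, hcard, hs, hprod, heval⟩ := exists_elemSym_factorization hk hkd hV hW hpos
  have h1 := (s.hasDerivAt_prod_one_add_mul).const_mul (elemSym k V)
  have h2 : c = elemSym k V * s.sum := by
    refine hc.unique ?_
    simpa only [heval] using h1
  rw [h2, mul_div_cancel_left₀ _ hpos.ne', hprod]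
  have h3 := s.prod_le_exp_sum_sub_card fun a ha => (hs a ha).le
  rw [hcard] at h3
  exact mul_le_mul_of_nonneg_left h3 hpos.le

theorem elemSym_le_add {d k : ℕ} (hk : 1 ≤ k) (hkd : k ≤ d)
    {V W : Matrix (Fin d) (Fin d) ℝ} (hV : V.PosSemidef) (hW : W.PosDef) :
    elemSym k V ≤ elemSym k (V + W) := by
  rcases (elemSym_nonneg hkd hV).eq_or_lt with h0 | hpos
  · rw [← h0]
    exact elemSym_nonneg hkd (hV.add hW.posSemidef)
  obtain ⟨s, -, hs, -, heval⟩ := exists_elemSym_factorization hk hkd hV hW hpos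
  have h1 := heval 1
  rw [one_smul] at h1
  rw [h1]
  refine le_mul_of_one_le_right hpos.le ?_
  refine Multiset.prod_induction (fun x : ℝ => 1 ≤ x) _ (fun a b => one_le_mul_of_one_le_of_one_le) le_rfl ?_
  intro x hx
  obtain ⟨a, ha, rfl⟩ := Multiset.mem_map.1 hx
  linarith [hs a ha]

/-! ### The gradient of `Psi k` and first-order bounds -/

theorem differentiable_Psi {d k : ℕ} (hkd : k ≤ d) :
    Differentiable ℝ fun A : Fin d → Fin d → ℝ => Psi k (Matrix.of A) := by
  simp only [Psi, elemSym_eq_sum_minors hkd, Matrix.det_apply', Matrix.submatrix_apply,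
    Matrix.of_apply]
  fun_prop

/-- The derivative of `Psi k` in the direction `W` is the pairing of its gradient with `W`. -/
theorem hasDerivAt_Psi {d k : ℕ} (hkd : k ≤ d) (V W : Matrix (Fin d) (Fin d) ℝ) :
    HasDerivAt (fun t : ℝ => Psi k (V + t • W)) (∑ i, ∑ j, gradPsi k V i j * W i j) 0 := by
  set F : (Fin d → Fin d → ℝ) → ℝ := fun A => Psi k (Matrix.of A) with hF
  set L := fderiv ℝ F (Matrix.of.symm V) with hL
  have key : ∀ W : Matrix (Fin d) (Fin d) ℝ,
      HasDerivAt (fun t : ℝ => Psi k (V + t • W)) (L (Matrix.of.symm W)) 0 := by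
    intro W
    have h1 : HasDerivAt (fun t : ℝ => Matrix.of.symm V + t • Matrix.of.symm W)
        (Matrix.of.symm W) 0 := by
      simpa using ((hasDerivAt_id (0 : ℝ)).smul_const (Matrix.of.symm W)).const_add
        (Matrix.of.symm V)
    have h2 : HasFDerivAt F L (Matrix.of.symm V + (0 : ℝ) • Matrix.of.symm W) := by
      rw [zero_smul, add_zero]
      exact (differentiable_Psi hkd _).hasFDerivAt
    exact h2.comp_hasDerivAt 0 h1
  convert key W using 1
  have hg : ∀ i j, gradPsi k V i j = L (Matrix.of.symm (Matrix.single i j 1)) := fun i j =>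
    (key (Matrix.single i j 1)).deriv
  have hW : Matrix.of.symm W =
      ∑ i, ∑ j, W i j • Matrix.of.symm (Matrix.single i j (1 : ℝ)) := by
    ext a b
    have hs : ∀ i j, Matrix.of.symm (Matrix.single i j (1 : ℝ)) a b =
        if i = a then if j = b then 1 else 0 else 0 := fun i j =>
      by
      rw [← ite_and]
      exact Matrix.single_apply i j (1 : ℝ) a b
    simp only [Finset.sum_apply, Pi.smul_apply, hs]
    simp
  rw [hW, map_sum]
  refine Finset.sum_congr rfl fun i _ => ?_
  rw [map_sum]
  refine Finset.sum_congr rfl fun j _ => ?_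
  rw [map_smul, hg, smul_eq_mul, mul_comm]

theorem Psi_smul {d k : ℕ} (hkd : k ≤ d) (c : ℝ) (V : Matrix (Fin d) (Fin d) ℝ) :
    Psi k (c • V) = c ^ k * Psi k V := by
  rw [Psi, Psi, elemSym_smul hkd]
  ring

/-- Euler's identity for the homogeneous function `Psi k`. -/
theorem sum_gradPsi_mul_self {d k : ℕ} (hkd : k ≤ d) (V : Matrix (Fin d) (Fin d) ℝ) :
    ∑ i, ∑ j, gradPsi k V i j * V i j = k * Psi k V := by
  refine (hasDerivAt_Psi hkd V V).unique ?_
  have h1 : (fun t : ℝ => Psi k (V + t • V)) = fun t : ℝ => (1 + t) ^ k * Psi k V := by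
    ext t
    rw [← Psi_smul hkd, add_smul, one_smul]
  rw [h1]
  have h2 := (((hasDerivAt_id (0 : ℝ)).const_add 1).pow k).mul_const (Psi k V)
  simpa using h2

theorem Psi_le_mul_exp {d k : ℕ} (hk : 1 ≤ k) (hkd : k ≤ d)
    {V W : Matrix (Fin d) (Fin d) ℝ} (hV : V.PosSemidef) (hW : W.PosDef) (hpos : 0 < Psi k V) :
    Psi k W ≤ Psi k V *
      Real.exp ((∑ i, ∑ j, gradPsi k V i j * W i j) / Psi k V - k) := by
  have hc : (0 : ℝ) < ((k : ℝ) + 1) / (k.factorial : ℝ) := by positivity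
  have hpos' : 0 < elemSym k V := pos_of_mul_pos_right hpos hc.le
  have h1 := (hasDerivAt_Psi hkd V W).const_mul (((k : ℝ) + 1) / (k.factorial : ℝ))⁻¹
  have h2 := elemSym_le_mul_exp hk hkd hV hW hpos' (c := (((k : ℝ) + 1) / (k.factorial : ℝ))⁻¹ *
    ∑ i, ∑ j, gradPsi k V i j * W i j) (by
      simpa only [Psi, inv_mul_cancel_left₀ hc.ne'] using h1)
  have h3 : (((k : ℝ) + 1) / (k.factorial : ℝ))⁻¹ *
      (∑ i, ∑ j, gradPsi k V i j * W i j) / elemSym k V =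
      (∑ i, ∑ j, gradPsi k V i j * W i j) / Psi k V := by
    rw [Psi]
    field_simp
  rw [h3] at h2
  rw [Psi, Psi, mul_assoc]
  exact mul_le_mul_of_nonneg_left h2 hc.le

theorem Psi_le_add {d k : ℕ} (hk : 1 ≤ k) (hkd : k ≤ d)
    {V W : Matrix (Fin d) (Fin d) ℝ} (hV : V.PosSemidef) (hW : W.PosDef) :
    Psi k V ≤ Psi k (V + W) :=
  mul_le_mul_of_nonneg_left (elemSym_le_add hk hkd hV hW) (by positivity)

/-- If `V` satisfies the first-order condition against `A + B`, then `Psi k A ≤ Psi k V`. -/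
theorem Psi_le_of_sum_gradPsi_le {d k : ℕ} (hk : 1 ≤ k) (hkd : k ≤ d)
    {V A B : Matrix (Fin d) (Fin d) ℝ} (hV : V.PosSemidef) (hpos : 0 < Psi k V)
    (hA : A.PosSemidef) (hB : B.PosSemidef)
    (h : ∑ i, ∑ j, gradPsi k V i j * (A + B) i j ≤ k * Psi k V) :
    Psi k A ≤ Psi k V := by
  set a := (∑ i, ∑ j, gradPsi k V i j * (A + B) i j) / Psi k V - k with ha
  set b := (∑ i, ∑ j, gradPsi k V i j * (1 : Matrix (Fin d) (Fin d) ℝ) i j) / Psi k V with hb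
  have ha0 : a ≤ 0 := sub_nonpos.2 ((div_le_iff₀ hpos).2 h)
  -- The bound needs a positive definite argument; adding `ε • 1` provides one, and `ε → 0`
  -- afterwards.
  have hε : ∀ ε : ℝ, 0 < ε → Psi k A ≤ Psi k V * Real.exp (a + b * ε) := by
    intro ε hε
    have h1 : (ε • (1 : Matrix (Fin d) (Fin d) ℝ)).PosDef := Matrix.PosDef.one.smul hε
    have h2 := Psi_le_add hk hkd hA (Matrix.PosDef.posSemidef_add hB h1)
    have h3 := Psi_le_mul_exp hk hkd hV
      (Matrix.PosDef.posSemidef_add hA (Matrix.PosDef.posSemidef_add hB h1)) hpos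
    refine (h2.trans h3).trans_eq ?_
    congr 2
    rw [ha, hb, ← add_assoc, sub_add_eq_add_sub, div_mul_eq_mul_div, ← add_div]
    congr 2
    simp only [Finset.sum_mul, ← Finset.sum_add_distrib]
    refine Finset.sum_congr rfl fun i _ => Finset.sum_congr rfl fun j _ => ?_
    simp only [Matrix.add_apply, Matrix.smul_apply, smul_eq_mul]
    ring
  have hlim : Filter.Tendsto (fun ε : ℝ => Psi k V * Real.exp (a + b * ε))
      (nhdsWithin 0 (Set.Ioi 0)) (nhds (Psi k V * Real.exp (a + b * 0))) :=
    ((by fun_prop : Continuous fun ε : ℝ => Psi k V * Real.exp (a + b * ε)).tendsto 0).mono_left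
      nhdsWithin_le_nhds
  have h1 : Psi k A ≤ Psi k V * Real.exp (a + b * 0) :=
    ge_of_tendsto hlim (by filter_upwards [self_mem_nhdsWithin] with ε h using hε ε h)
  refine h1.trans (mul_le_of_le_one_right hpos.le ?_)
  rw [mul_zero, add_zero]
  exact Real.exp_le_one_iff.2 ha0

/-! ### Mean squared simplex volume as a function of the covariance -/

/-- **Andréief's identity** for the integral of a squared determinant. -/
theorem integral_sq_det {Ω : Type*} [MeasurableSpace Ω] {n : ℕ} (μ : Measure Ω) [SigmaFinite μ]
    (g : Fin n → Ω → ℝ) (hg : ∀ i j, Integrable (fun x => g i x * g j x) μ) :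
    Integrable (fun x : Fin n → Ω => (Matrix.of fun i j => g j (x i)).det ^ 2)
        (Measure.pi fun _ => μ) ∧
      ∫ x : Fin n → Ω, (Matrix.of fun i j => g j (x i)).det ^ 2 ∂(Measure.pi fun _ => μ) =
      (n.factorial : ℝ) * (Matrix.of fun i j => ∫ x, g i x * g j x ∂μ).det := by
  have hexp : ∀ x : Fin n → Ω, (Matrix.of fun i j => g j (x i)).det ^ 2 =
      ∑ σ : Equiv.Perm (Fin n), ∑ τ : Equiv.Perm (Fin n),
        (((Equiv.Perm.sign σ : ℤ) : ℝ) * ((Equiv.Perm.sign τ : ℤ) : ℝ)) *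
          ∏ i, (g (σ i) (x i) * g (τ i) (x i)) := by
    intro x
    rw [sq, ← Matrix.det_transpose, Matrix.det_apply', Finset.sum_mul_sum]
    refine Finset.sum_congr rfl fun σ _ => Finset.sum_congr rfl fun τ _ => ?_
    simp only [Matrix.transpose_apply, Matrix.of_apply, Finset.prod_mul_distrib]
    ring
  have hint : ∀ σ τ : Equiv.Perm (Fin n), Integrable
      (fun x : Fin n → Ω => (((Equiv.Perm.sign σ : ℤ) : ℝ) * ((Equiv.Perm.sign τ : ℤ) : ℝ)) *
          ∏ i, (g (σ i) (x i) * g (τ i) (x i))) (Measure.pi fun _ => μ) := by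
    intro σ τ
    refine Integrable.const_mul ?_ _
    exact Integrable.fintype_prod (f := fun i x => g (σ i) x * g (τ i) x)
      fun i => hg (σ i) (τ i)
  simp only [hexp]
  refine ⟨integrable_finsetSum _ fun σ _ => integrable_finsetSum _ fun τ _ => hint σ τ, ?_⟩
  rw [integral_finsetSum _ fun σ _ => integrable_finsetSum _ fun τ _ => hint σ τ]
  have hterm : ∀ σ : Equiv.Perm (Fin n), ∫ x : Fin n → Ω, ∑ τ : Equiv.Perm (Fin n),
        (((Equiv.Perm.sign σ : ℤ) : ℝ) * ((Equiv.Perm.sign τ : ℤ) : ℝ)) *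
          ∏ i, (g (σ i) (x i) * g (τ i) (x i)) ∂(Measure.pi fun _ => μ) =
      (Matrix.of fun i j => ∫ x, g i x * g j x ∂μ).det := by
    intro σ
    set G : Matrix (Fin n) (Fin n) ℝ := Matrix.of fun i j => ∫ x, g i x * g j x ∂μ with hG
    rw [integral_finsetSum _ fun τ _ => hint σ τ]
    -- For fixed `σ` the sum over `τ` is `sign σ` times the determinant of `G` with rows permuted by
    -- `σ`, hence `det G`; there are `n!` choices of `σ`.
    have h1 := Matrix.det_permute σ G
    rw [← Matrix.det_transpose, Matrix.det_apply'] at h1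
    have h2 : ((Equiv.Perm.sign σ : ℤ) : ℝ) * ((Equiv.Perm.sign σ : ℤ) : ℝ) = 1 := by
      rw [← Int.cast_mul, ← Units.val_mul, Int.units_mul_self]
      simp
    calc _ = ((Equiv.Perm.sign σ : ℤ) : ℝ) * ∑ τ : Equiv.Perm (Fin n),
          ((Equiv.Perm.sign τ : ℤ) : ℝ) * ∏ i, (G.submatrix σ id)ᵀ (τ i) i := by
          rw [Finset.mul_sum]
          refine Finset.sum_congr rfl fun τ _ => ?_
          rw [integral_const_mul,
            integral_fintype_prod_eq_prod (fun i x => g (σ i) x * g (τ i) x), mul_assoc]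
          rfl
      _ = _ := by rw [h1, ← mul_assoc, h2, one_mul]
  rw [Finset.sum_congr rfl fun σ _ => hterm σ]
  simp [Fintype.card_perm]

/-- A form of Cauchy–Binet: the characteristic polynomials of `AᵀA` and `AAᵀ` differ by the factor
`X ^ (d - k)`, so the coefficient of degree `d - k` of the first is the constant coefficient of the
second. -/
theorem det_gram_eq_sum_minors {d k : ℕ} (hkd : k ≤ d) (y : Fin k → E d) :
    (Matrix.gram ℝ y).det = ∑ s ∈ Finset.univ.powersetCard k,
      (((Matrix.of fun i j => y i j)ᵀ * Matrix.of fun i j => y i j).submatrix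
        (Subtype.val : s → Fin d) Subtype.val).det := by
  set A : Matrix (Fin k) (Fin d) ℝ := Matrix.of fun i j => y i j with hA
  have hgram : Matrix.gram ℝ y = A * Aᵀ := by
    ext i j
    simp [Matrix.gram_apply, Matrix.mul_apply, PiLp.inner_apply, hA, mul_comm]
  have h1 := Matrix.charpoly_mul_comm_of_le Aᵀ A (by simpa using hkd)
  have h2 := congrArg (fun p => p.coeff (d - k)) h1
  simp only [Fintype.card_fin, coeff_X_pow_mul'] at h2
  rw [if_pos le_rfl, Nat.sub_self] at h2
  rw [← elemSym_eq_sum_minors hkd, elemSym, hgram, Matrix.det_eq_sign_charpoly_coeff,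
    Fintype.card_fin, ← h2]

/-- Subtracting row `0` from the other rows cancels `m`, which may therefore be chosen as the mean.
-/
theorem det_sub_eq_det_cons {n : ℕ} (w : Fin (n + 1) → Fin n → ℝ) (m : Fin n → ℝ) :
    (Matrix.of fun i j => w (Fin.succ i) j - w 0 j).det =
      (Matrix.of fun (i j : Fin (n + 1)) =>
        (Fin.cons 1 (fun l => w i l - m l) : Fin (n + 1) → ℝ) j).det := by
  have h := Matrix.det_eq_of_forall_row_eq_smul_add_const
    (A := Matrix.of fun (i j : Fin (n + 1)) =>
        (Fin.cons 1 (fun l => w i l - m l) : Fin (n + 1) → ℝ) j)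
    (B := Matrix.of fun (i j : Fin (n + 1)) => if i = 0 then
        (Fin.cons 1 (fun l => w i l - m l) : Fin (n + 1) → ℝ) j else
        (Fin.cons 0 (fun l => w i l - w 0 l) : Fin (n + 1) → ℝ) j)
    (fun i => if i = 0 then 0 else 1) 0 (by simp) (by
      intro i j
      rcases eq_or_ne i 0 with rfl | hi
      · simp
      · refine Fin.cases ?_ (fun l => ?_) j <;> simp [hi])
  rw [h, Matrix.det_succ_column_zero, Finset.sum_eq_single 0]
  · simp [Matrix.submatrix]
  · intro i _ hi
    simp [hi]
  · simp

theorem integrable_of_continuous_of_compact {d : ℕ} {X : Set (E d)} (hX : IsCompact X)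
    {μ : Measure (E d)} (hμ : μ ∈ probMeasures X) {f : E d → ℝ} (hf : Continuous f) :
    Integrable f μ := by
  have := hμ.1
  have h1 : IntegrableOn f X μ := hf.continuousOn.integrableOn_compact hX
  rwa [IntegrableOn, Measure.restrict_eq_self_of_ae_mem] at h1
  exact hμ.2

theorem mean_apply {d : ℕ} {X : Set (E d)} (hX : IsCompact X)
    {μ : Measure (E d)} (hμ : μ ∈ probMeasures X) (i : Fin d) :
    mean μ i = ∫ x, x i ∂μ := by
  have := hμ.1
  have h1 : IntegrableOn (fun x : E d => x) X μ := continuousOn_id.integrableOn_compact hX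
  rw [IntegrableOn, Measure.restrict_eq_self_of_ae_mem hμ.2] at h1
  exact (ContinuousLinearMap.integral_comp_comm (EuclideanSpace.proj (𝕜 := ℝ) i) h1).symm

theorem covMatrix_apply {d : ℕ} {X : Set (E d)} (hX : IsCompact X)
    {μ : Measure (E d)} (hμ : μ ∈ probMeasures X) (i j : Fin d) :
    covMatrix μ i j = ∫ x, (x i - mean μ i) * (x j - mean μ j) ∂μ := by
  rw [mean_apply hX hμ, mean_apply hX hμ]
  rfl

theorem integral_sub_mean {d : ℕ} {X : Set (E d)} (hX : IsCompact X)
    {μ : Measure (E d)} (hμ : μ ∈ probMeasures X) (i : Fin d) :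
    ∫ x, (x i - mean μ i) ∂μ = 0 := by
  have := hμ.1
  rw [integral_sub (integrable_of_continuous_of_compact hX hμ (by fun_prop)) (integrable_const _),
    mean_apply hX hμ]
  simp

/-- The mean squared volume of a random simplex depends on the covariance matrix only. -/
theorem psi_eq_Psi {d k : ℕ} (hkd : k ≤ d) {X : Set (E d)} (hX : IsCompact X)
    {μ : Measure (E d)} (hμ : μ ∈ probMeasures X) : psi k μ = Psi k (covMatrix μ) := by
  have := hμ.1
  have hsq : ∀ x : Fin (k + 1) → E d, simplexVolume x ^ 2 = ∑ s ∈ Finset.univ.powersetCard k,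
      (((Matrix.of fun (i : Fin k) j => (x i.succ - x 0) j)ᵀ *
        Matrix.of fun (i : Fin k) j => (x i.succ - x 0) j).submatrix
        (Subtype.val : s → Fin d) Subtype.val).det / (k.factorial : ℝ) ^ 2 := by
    intro x
    rw [simplexVolume, div_pow, Real.sq_sqrt (Matrix.posSemidef_gram ℝ _).det_nonneg,
      det_gram_eq_sum_minors hkd, Finset.sum_div]
  have hminor : ∀ s ∈ Finset.univ.powersetCard k,
      Integrable (fun x : Fin (k + 1) → E d =>
        (((Matrix.of fun (i : Fin k) j => (x i.succ - x 0) j)ᵀ *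
        Matrix.of fun (i : Fin k) j => (x i.succ - x 0) j).submatrix
        (Subtype.val : s → Fin d) Subtype.val).det) (Measure.pi fun _ => μ) ∧
      ∫ x : Fin (k + 1) → E d,
        (((Matrix.of fun (i : Fin k) j => (x i.succ - x 0) j)ᵀ *
        Matrix.of fun (i : Fin k) j => (x i.succ - x 0) j).submatrix
        (Subtype.val : s → Fin d) Subtype.val).det ∂(Measure.pi fun _ => μ) =
      ((k + 1).factorial : ℝ) *
        ((covMatrix μ).submatrix (Subtype.val : s → Fin d) Subtype.val).det := by
    intro s hs
    set e : Fin k ≃ s := (s.equivFinOfCardEq (Finset.mem_powersetCard.1 hs).2).symm with he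
    -- The constant `1` and the centred coordinates: the former is orthogonal to the latter, so
    -- their moment matrix is block diagonal with blocks `1` and the covariance minor.
    set g : Fin (k + 1) → E d → ℝ := fun j x =>
      (Fin.cons 1 (fun l => x (e l) - mean μ (e l)) : Fin (k + 1) → ℝ) j with hg
    have h1 : ∀ x : Fin (k + 1) → E d,
        (((Matrix.of fun (i : Fin k) j => (x i.succ - x 0) j)ᵀ *
        Matrix.of fun (i : Fin k) j => (x i.succ - x 0) j).submatrix
        (Subtype.val : s → Fin d) Subtype.val).det =
        (Matrix.of fun i j => g j (x i)).det ^ 2 := by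
      intro x
      rw [← Matrix.det_submatrix_equiv_self e, Matrix.submatrix_submatrix,
        ← Matrix.submatrix_mul_equiv _ _ _ (Equiv.refl _) _, Matrix.det_mul,
        ← Matrix.transpose_submatrix, Matrix.det_transpose, ← sq]
      congr 1
      exact det_sub_eq_det_cons (fun i l => x i (e l)) fun l => mean μ (e l)
    have hcont : ∀ j, Continuous (g j) := by
      intro j
      refine Fin.cases ?_ (fun l => ?_) j
      · simpa [hg] using continuous_const
      · simp only [hg, Fin.cons_succ]
        fun_prop
    have h2 := integral_sq_det μ g fun i j =>
      integrable_of_continuous_of_compact hX hμ ((hcont i).mul (hcont j))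
    simp only [h1]
    refine ⟨h2.1, h2.2.trans ?_⟩
    congr 1
    rw [← Matrix.det_submatrix_equiv_self e, Matrix.det_succ_column_zero, Finset.sum_eq_single 0]
    · simp only [hg, Fin.val_zero, pow_zero, Matrix.of_apply, Fin.cons_zero, mul_one,
        integral_const, probReal_univ, smul_eq_mul, Fin.succAbove_zero, one_mul]
      congr 1
      ext i j
      simp [covMatrix_apply hX hμ]
    · intro i _ hi
      obtain ⟨l, rfl⟩ := Fin.exists_succ_eq.2 hi
      have := integral_sub_mean hX hμ (e l)
      simp [hg, this]
    · simp
  rw [psi]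
  simp only [hsq]
  rw [integral_finsetSum _ fun s hs => (hminor s hs).1.div_const _, Psi,
    elemSym_eq_sum_minors hkd, Finset.mul_sum]
  refine Finset.sum_congr rfl fun s hs => ?_
  -- The constant is `(k+1)! / (k!)² = (k+1) / k!`.
  rw [integral_div, (hminor s hs).2, Nat.factorial_succ]
  push_cast
  field_simp

theorem posSemidef_covMatrix {d : ℕ} {X : Set (E d)} (hX : IsCompact X)
    {μ : Measure (E d)} (hμ : μ ∈ probMeasures X) : (covMatrix μ).PosSemidef := by
  refine Matrix.PosSemidef.of_dotProduct_mulVec_nonneg ?_ fun v => ?_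
  · ext i j
    exact ProbabilityTheory.covariance_comm _ _
  · have h1 : star v ⬝ᵥ (covMatrix μ *ᵥ v) = ∫ x, (∑ i, v i * (x i - mean μ i)) ^ 2 ∂μ := by
      simp only [sq, Finset.sum_mul_sum]
      rw [integral_finsetSum _ fun i _ =>
        integrable_of_continuous_of_compact hX hμ (by fun_prop)]
      simp only [dotProduct, Matrix.mulVec, Finset.mul_sum, star_trivial]
      refine Finset.sum_congr rfl fun i _ => ?_
      rw [integral_finsetSum _ fun j _ =>
        integrable_of_continuous_of_compact hX hμ (by fun_prop)]
      refine Finset.sum_congr rfl fun j _ => ?_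
      rw [covMatrix_apply hX hμ, ← integral_mul_const, ← integral_const_mul]
      congr 1
      ext x
      ring
    rw [h1]
    exact integral_nonneg fun x => sq_nonneg _

/-- The matrix of second moments of `ν` about an arbitrary point `m`. -/
theorem integral_sub_mul_sub {d : ℕ} {X : Set (E d)} (hX : IsCompact X)
    {ν : Measure (E d)} (hν : ν ∈ probMeasures X) (m : E d) (i j : Fin d) :
    ∫ x, (x i - m i) * (x j - m j) ∂ν =
      covMatrix ν i j + (mean ν i - m i) * (mean ν j - m j) := by
  have := hν.1
  have hint : ∀ f : E d → ℝ, Continuous f → Integrable f ν := fun f hf =>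
    integrable_of_continuous_of_compact hX hν hf
  have h1 : ∀ x : E d, (x i - m i) * (x j - m j) =
      (x i - mean ν i) * (x j - mean ν j) + ((x i - mean ν i) * (mean ν j - m j) +
        ((mean ν i - m i) * (x j - mean ν j) + (mean ν i - m i) * (mean ν j - m j))) := by
    intro x; ring
  rw [integral_congr_ae (Filter.Eventually.of_forall h1), integral_add (hint _ (by fun_prop)) (hint _ (by fun_prop)),
    integral_add (hint _ (by fun_prop)) (hint _ (by fun_prop)),
    integral_add (hint _ (by fun_prop)) (hint _ (by fun_prop)),
    integral_mul_const, integral_const_mul, integral_sub_mean hX hν, integral_sub_mean hX hν,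
    covMatrix_apply hX hν, zero_mul, mul_zero, zero_add, zero_add, integral_const,
    probReal_univ, one_smul]

/-! ### Sensitivity and mixtures with point masses -/

theorem sensitivity_eq_sum {d k : ℕ} (μ : Measure (E d)) (x : E d) :
    sensitivity k μ x = (Psi k (covMatrix μ))⁻¹ *
      ∑ i, ∑ j, gradPsi k (covMatrix μ) i j * ((x i - mean μ i) * (x j - mean μ j)) := by
  rw [sensitivity, Matrix.smul_mulVec, dotProduct_smul, smul_eq_mul]
  simp only [dotProduct, Matrix.mulVec, Finset.mul_sum, PiLp.sub_apply]
  refine Finset.sum_congr rfl fun i _ => Finset.sum_congr rfl fun j _ => ?_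
  ring

theorem continuous_sensitivity {d k : ℕ} (μ : Measure (E d)) :
    Continuous (sensitivity k μ) := by
  rw [funext (sensitivity_eq_sum (k := k) μ)]
  fun_prop

theorem integral_sensitivity {d k : ℕ} {X : Set (E d)} (hX : IsCompact X)
    (μ : Measure (E d)) {ν : Measure (E d)} (hν : ν ∈ probMeasures X) :
    ∫ x, sensitivity k μ x ∂ν = (Psi k (covMatrix μ))⁻¹ *
      ∑ i, ∑ j, gradPsi k (covMatrix μ) i j *
        (covMatrix ν + Matrix.vecMulVec (mean ν - mean μ).ofLp (mean ν - mean μ).ofLp) i j := by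
  simp only [sensitivity_eq_sum]
  rw [integral_const_mul, integral_finsetSum _ fun i _ =>
        integrable_of_continuous_of_compact hX hν (by fun_prop)]
  congr 1
  refine Finset.sum_congr rfl fun i _ => ?_
  rw [integral_finsetSum _ fun j _ =>
        integrable_of_continuous_of_compact hX hν (by fun_prop)]
  refine Finset.sum_congr rfl fun j _ => ?_
  rw [integral_const_mul, integral_sub_mul_sub hX hν]
  rfl

theorem posSemidef_vecMulVec_self {d : ℕ} (u : Fin d → ℝ) :
    (Matrix.vecMulVec u u).PosSemidef := by
  simpa using Matrix.posSemidef_vecMulVec_self_star u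

/-- The mixture of `μ` with the point mass at `x`. -/
noncomputable def mixDirac {d : ℕ} (μ : Measure (E d)) (x : E d) (a : ℝ) : Measure (E d) :=
  ENNReal.ofReal (1 - a) • μ + ENNReal.ofReal a • Measure.dirac x

theorem mixDirac_mem {d : ℕ} {X : Set (E d)} (hX : IsCompact X)
    {μ : Measure (E d)} (hμ : μ ∈ probMeasures X) {x : E d} (hx : x ∈ X) {a : ℝ}
    (ha : a ∈ Set.Icc (0 : ℝ) 1) : mixDirac μ x a ∈ probMeasures X := by
  have := hμ.1
  refine ⟨⟨?_⟩, ?_⟩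
  · simp only [mixDirac, Measure.add_apply, Measure.smul_apply, measure_univ, smul_eq_mul, mul_one]
    rw [← ENNReal.ofReal_add (by linarith [ha.2]) ha.1]
    simp
  · have h1 : Measure.dirac x Xᶜ = 0 := by
      rw [Measure.dirac_apply' _ hX.isClosed.measurableSet.compl]
      simp [hx]
    simp [mixDirac, hμ.2, h1]

theorem integral_mixDirac {d : ℕ} {X : Set (E d)} (hX : IsCompact X)
    {μ : Measure (E d)} (hμ : μ ∈ probMeasures X) (x : E d) {a : ℝ}
    (ha : a ∈ Set.Icc (0 : ℝ) 1) {f : E d → ℝ} (hf : Continuous f) :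
    ∫ y, f y ∂(mixDirac μ x a) = (1 - a) * ∫ y, f y ∂μ + a * f x := by
  have h1 := integrable_of_continuous_of_compact hX hμ hf
  have h2 : Integrable f (Measure.dirac x) := integrable_dirac (by simp)
  rw [mixDirac, integral_add_measure (h1.smul_measure ENNReal.ofReal_ne_top)
    (h2.smul_measure ENNReal.ofReal_ne_top), integral_smul_measure, integral_smul_measure,
    integral_dirac, ENNReal.toReal_ofReal ha.1, ENNReal.toReal_ofReal (by linarith [ha.2])]
  rfl

theorem covMatrix_mixDirac {d : ℕ} {X : Set (E d)} (hX : IsCompact X)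
    {μ : Measure (E d)} (hμ : μ ∈ probMeasures X) {x : E d} (hx : x ∈ X) {a : ℝ}
    (ha : a ∈ Set.Icc (0 : ℝ) 1) :
    covMatrix (mixDirac μ x a) = (1 - a) • (covMatrix μ +
      a • Matrix.vecMulVec (x - mean μ).ofLp (x - mean μ).ofLp) := by
  have hν := mixDirac_mem hX hμ hx ha
  have hm : ∀ i, mean (mixDirac μ x a) i - mean μ i = a * (x i - mean μ i) := by
    intro i
    rw [mean_apply hX hν, mean_apply hX hμ, integral_mixDirac hX hμ x ha (by fun_prop)]
    ring
  ext i j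
  have h1 := integral_sub_mul_sub hX hν (mean μ) i j
  rw [integral_mixDirac hX hμ x ha (by fun_prop), ← covMatrix_apply hX hμ, hm, hm] at h1
  simp only [Matrix.smul_apply, Matrix.add_apply, Matrix.vecMulVec_apply, PiLp.sub_apply,
    smul_eq_mul]
  -- Second moments about the old mean are `(1 - a) V + a U`; removing the shift `a² U` of the mean
  -- leaves `(1 - a) (V + a U)`.
  linear_combination -h1

/-! ### The optimality criterion -/

theorem sensitivity_le_of_isMaxOn {d k : ℕ} (hkd : k ≤ d) {X : Set (E d)} (hX : IsCompact X)
    {μ : Measure (E d)} (hμ : μ ∈ probMeasures X) (hpos : 0 < psi k μ)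
    (hmax : IsMaxOn (psi k) (probMeasures X) μ) {x : E d} (hx : x ∈ X) :
    sensitivity k μ x ≤ k := by
  rw [psi_eq_Psi hkd hX hμ] at hpos
  set V := covMatrix μ with hV
  set U := Matrix.vecMulVec (x - mean μ).ofLp (x - mean μ).ofLp with hU
  -- On `[0, 1]` this is `psi k` along the mixture, by homogeneity; only its right-hand slope at `0`
  -- is constrained.
  set h : ℝ → ℝ := fun a => (1 - a) ^ k * Psi k (V + a • U) with hh
  set G := ∑ i, ∑ j, gradPsi k V i j * U i j with hG
  have hderiv : HasDerivAt h (-(k * Psi k V) + G) 0 := by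
    have h1 : HasDerivAt (fun a : ℝ => (1 - a) ^ k) (-(k : ℝ)) 0 := by
      simpa using ((hasDerivAt_id (0 : ℝ)).const_sub 1).fun_pow k
    simpa using h1.fun_mul (hasDerivAt_Psi hkd V U)
  have hle : ∀ a ∈ Set.Icc (0 : ℝ) 1, h a ≤ h 0 := by
    intro a ha
    have h1 := hmax (mixDirac_mem hX hμ hx ha)
    simp only [Set.mem_ofPred_eq] at h1
    rw [psi_eq_Psi hkd hX hμ, psi_eq_Psi hkd hX (mixDirac_mem hX hμ hx ha),
      covMatrix_mixDirac hX hμ hx ha, Psi_smul hkd] at h1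
    have h0 : h 0 = Psi k V := by simp [hh]
    rw [h0, hh]
    simpa only [mul_pow, mul_assoc] using h1
  have hslope := (hasDerivWithinAt_iff_tendsto_slope' (s := Set.Ioi (0 : ℝ)) (by simp)).1
    hderiv.hasDerivWithinAt
  have hc : -(k * Psi k V) + G ≤ 0 := by
    refine le_of_tendsto hslope ?_
    filter_upwards [Ioo_mem_nhdsGT (zero_lt_one (α := ℝ))] with a ha
    rw [slope_def_field]
    exact div_nonpos_of_nonpos_of_nonneg (sub_nonpos.2 (hle a ⟨ha.1.le, ha.2.le⟩))
      (by linarith [ha.1])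
  have h2 : sensitivity k μ x = (Psi k V)⁻¹ * G := sensitivity_eq_sum μ x
  rw [h2, inv_mul_le_iff₀ hpos]
  linarith

theorem isMaxOn_of_sensitivity_le {d k : ℕ} (hk : 1 ≤ k) (hkd : k ≤ d) {X : Set (E d)}
    (hX : IsCompact X) {μ : Measure (E d)} (hμ : μ ∈ probMeasures X) (hpos : 0 < psi k μ)
    (h : ∀ x ∈ X, sensitivity k μ x ≤ k) : IsMaxOn (psi k) (probMeasures X) μ := by
  intro ν hν
  have := hν.1
  simp only [Set.mem_ofPred_eq]
  rw [psi_eq_Psi hkd hX hμ] at hpos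
  rw [psi_eq_Psi hkd hX hμ, psi_eq_Psi hkd hX hν]
  refine Psi_le_of_sum_gradPsi_le hk hkd (posSemidef_covMatrix hX hμ) hpos
    (posSemidef_covMatrix hX hν)
    (posSemidef_vecMulVec_self (mean ν - mean μ).ofLp) ?_
  -- Averaging the pointwise bound over `ν` gives the first-order condition, with the shift of the
  -- mean as the positive semidefinite extra term.
  have h1 : ∫ x, sensitivity k μ x ∂ν ≤ ∫ _, (k : ℝ) ∂ν := by
    refine integral_mono_ae (integrable_of_continuous_of_compact hX hν
      (continuous_sensitivity μ)) (integrable_const _) ?_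
    filter_upwards [show ∀ᵐ x ∂ν, x ∈ X from hν.2] with x hx using h x hx
  rw [integral_sensitivity hX μ hν, integral_const, probReal_univ, one_smul,
    inv_mul_le_iff₀ hpos] at h1
  linarith

/-- The nonnegative gap `k - sensitivity` has zero integral by Euler's identity, so it vanishes
almost everywhere; by continuity its zero set is closed and contains the support. -/
theorem sensitivity_eq_of_mem_support {d k : ℕ} (hkd : k ≤ d) {X : Set (E d)}
    (hX : IsCompact X) {μ : Measure (E d)} (hμ : μ ∈ probMeasures X) (hpos : 0 < psi k μ)
    (h : ∀ x ∈ X, sensitivity k μ x ≤ k) {x : E d} (hx : x ∈ μ.support) :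
    sensitivity k μ x = k := by
  have := hμ.1
  rw [psi_eq_Psi hkd hX hμ] at hpos
  have hint := integrable_of_continuous_of_compact hX hμ (continuous_sensitivity (k := k) μ)
  have h0 : ∫ x, ((k : ℝ) - sensitivity k μ x) ∂μ = 0 := by
    rw [integral_sub (integrable_const _) hint, integral_sensitivity hX μ hμ]
    simp only [sub_self, WithLp.ofLp_zero, Matrix.zero_vecMulVec, add_zero]
    rw [sum_gradPsi_mul_self hkd, integral_const, probReal_univ, one_smul]
    field_simp
    simp
  have h1 := (integral_eq_zero_iff_of_nonneg_ae (by
    filter_upwards [show ∀ᵐ x ∂μ, x ∈ X from hμ.2] with x hx using sub_nonneg.2 (h x hx))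
    ((integrable_const _).sub hint)).1 h0
  have h2 : {x | sensitivity k μ x = k} ∈ ae μ := by
    filter_upwards [h1] with x hx
    exact (sub_eq_zero.1 hx).symm
  exact Measure.support_subset_of_isClosed
    (isClosed_eq (continuous_sensitivity μ) continuous_const) h2 hx

theorem theorem3 {d k : ℕ} (hk : 1 ≤ k) (hkd : k ≤ d)
    (X : Set (MaxDiversity.E d)) (hX : IsCompact X)
    (μ : MeasureTheory.Measure (MaxDiversity.E d)) (hμ : μ ∈ MaxDiversity.probMeasures X)
    (hpos : 0 < MaxDiversity.psi k μ) :
    (IsMaxOn (MaxDiversity.psi k) (MaxDiversity.probMeasures X) μ ↔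
      ∃ m : ℝ, IsGreatest (MaxDiversity.sensitivity k μ '' X) m ∧ m ≤ k) ∧
    (IsMaxOn (MaxDiversity.psi k) (MaxDiversity.probMeasures X) μ →
      ∀ x ∈ μ.support, MaxDiversity.sensitivity k μ x = k) := by
  refine ⟨⟨fun hmax => ?_, ?_⟩, fun hmax x hx => ?_⟩
  · have := hμ.1
    have hne : X.Nonempty := by
      rw [Set.nonempty_iff_ne_empty]
      rintro rfl
      have := hμ.2
      simp at this
    obtain ⟨m, hm⟩ := (hX.image (continuous_sensitivity (k := k) μ)).exists_isGreatest
      (hne.image _)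
    refine ⟨m, hm, ?_⟩
    obtain ⟨x, hx, rfl⟩ := hm.1
    exact sensitivity_le_of_isMaxOn hkd hX hμ hpos hmax hx
  · rintro ⟨m, hm, hmk⟩
    exact isMaxOn_of_sensitivity_le hk hkd hX hμ hpos fun x hx =>
      (hm.2 (Set.mem_image_of_mem _ hx)).trans hmk
  · exact sensitivity_eq_of_mem_support hkd hX hμ hpos
      (fun y hy => sensitivity_le_of_isMaxOn hkd hX hμ hpos hmax hy) hx
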